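/- Let $N,d\ge 1$. In the symmetric CNS-QRAC game with $N$ inputs of dimension $d$, the inputs $A_1,\dots,A_N$ are $d$-dimensional systems, each maximally entangled with a reference $A'_1,\dots,A'_N$: their joint state is $\psi^+_{A'A}=\bigotimes_{j=1}^N\psi^+_{A'_jA_j}$, where $\psi^+=|\psi^+\rangle\langle\psi^+|$ and $|\psi^+\rangle=\frac1{\sqrt d}\sum_{i=1}^d|ii\rangle$. Alice and Bob share an arbitrary state $\rho_{\widetilde A B}$, where $\widetilde A$ has arbitrary finite dimension and Bob's system $B$ has dimension $d$. Alice performs an arbitrary joint measurement (POVM) $\{M^{(i)}_{A\widetilde A}\}_{i=1}^K$, with $K$ arbitrary, on $A=A_1\cdots A_N$ and $\widetilde A$, and sends the outcome $i$ to Bob. To recover the $j$-th input Bob applies to $B$ a unitary $U_B^{(i,j)}$ depending on $i$ and on $j$. Since $j$ is uniformly distributed on $\{1,\dots,N\}$, the probability of success of the strategy is the average entanglement fidelity $$P_{\mathrm{succ}}^{\mathrm{QM}}=\frac1N\sum_{j=1}^N\sum_{i=1}^K\operatorname{tr}\Big[\psi^+_{A'_jB}\,U_B^{(i,j)}M^{(i)}_{A\widetilde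 A}\big(\psi^+_{A'A}\otimes\rho_{\widetilde AB}\big)U_B^{(i,j)\dagger}\Big].$$ Every such strategy satisfies $$P_{\mathrm{succ}}^{\mathrm{QM}}\le\frac{N+d-1}{dN}.$$ -/

import Mathlib

open scoped Kronecker Matrix BigOperators ComplexOrder

noncomputable section

namespace CNSQRAC

/-- Index set of the computational basis of `N` qudits of dimension `d`. -/
abbrev Qudits (N d : ℕ) : Type := Fin N → Fin d

/-- The maximally entangled vector `(1/√d) ∑ i, |i i⟩` of two `d`-dimensional systems. -/
def maxEntVec (d : ℕ) : Fin d × Fin d → ℂ :=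
  fun x => if x.1 = x.2 then (((Real.sqrt d)⁻¹ : ℝ) : ℂ) else 0

/-- The maximally entangled state `ψ⁺ = |ψ⁺⟩⟨ψ⁺|` of two `d`-dimensional systems. -/
def maxEnt (d : ℕ) : Matrix (Fin d × Fin d) (Fin d × Fin d) ℂ :=
  Matrix.vecMulVec (maxEntVec d) (star (maxEntVec d))

/-- The singlet fraction (entanglement fidelity) `F(τ) = ⟨ψ⁺|τ|ψ⁺⟩ = tr(ψ⁺ τ)`. -/
def singletFraction {d : ℕ} (τ : Matrix (Fin d × Fin d) (Fin d × Fin d) ℂ) : ℝ :=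
  (Matrix.trace (maxEnt d * τ)).re

/-- The state `⨂ⱼ ψ⁺` of the `N` reference systems `A'ⱼ` and the `N` inputs `Aⱼ`
(first component: references `A'`, second component: inputs `A`). -/
def inputState (N d : ℕ) : Matrix (Qudits N d × Qudits N d) (Qudits N d × Qudits N d) ℂ :=
  fun x y => ∏ j, maxEnt d (x.1 j, x.2 j) (y.1 j, y.2 j)

/-- A (one-way LOCC) quantum strategy for the CNS-QRAC game with `N` inputs of dimension `d`. -/
structure Strategy (N d : ℕ) where
  /-- dimension of Alice's part `Ã` of the shared state -/
  m : ℕ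
  /-- the shared state of `Ã` and `B`, where Bob's system `B` has dimension `d` -/
  ρ : Matrix (Fin m × Fin d) (Fin m × Fin d) ℂ
  ρ_posSemidef : ρ.PosSemidef
  ρ_trace : ρ.trace = 1
  /-- number of classical messages; it is not bounded -/
  K : ℕ
  /-- Alice's joint measurement (POVM) on her `N` inputs `A` and on `Ã` -/
  M : Fin K → Matrix (Qudits N d × Fin m) (Qudits N d × Fin m) ℂ
  M_posSemidef : ∀ i, (M i).PosSemidef
  M_sum : ∑ i, M i = 1
  /-- Bob's unitary on `B`, given the message `i` and his choice `j` of the input to recover -/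
  U : Fin K → Fin N → Matrix.unitaryGroup (Fin d) ℂ

namespace Strategy

variable {N d : ℕ} (S : Strategy N d)

/-- The initial state `(⨂ⱼ ψ⁺) ⊗ ρ`, with the systems grouped as `(A Ã) (A' B)`. -/
def initialState :
    Matrix ((Qudits N d × Fin S.m) × (Qudits N d × Fin d))
      ((Qudits N d × Fin S.m) × (Qudits N d × Fin d)) ℂ :=
  fun x y => inputState N d (x.2.1, x.1.1) (y.2.1, y.1.1) * S.ρ (x.1.2, x.2.2) (y.1.2, y.2.2)

/-- The unnormalised state of `A' B` after Alice's outcome `i`: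
the partial trace over `A Ã` of `(Mᵢ ⊗ 1) · initialState`. -/
def postState (i : Fin S.K) : Matrix (Qudits N d × Fin d) (Qudits N d × Fin d) ℂ :=
  fun x y => ∑ z, (((S.M i) ⊗ₖ (1 : Matrix (Qudits N d × Fin d) (Qudits N d × Fin d) ℂ))
    * S.initialState) (z, x) (z, y)

/-- The unnormalised state of `A' B` after the outcome `i` and Bob's unitary for the choice `j`. -/
def correctedState (i : Fin S.K) (j : Fin N) :
    Matrix (Qudits N d × Fin d) (Qudits N d × Fin d) ℂ :=
  ((1 : Matrix (Qudits N d) (Qudits N d) ℂ) ⊗ₖ (S.U i j : Matrix (Fin d) (Fin d) ℂ))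
    * S.postState i
    * ((1 : Matrix (Qudits N d) (Qudits N d) ℂ) ⊗ₖ (S.U i j : Matrix (Fin d) (Fin d) ℂ))ᴴ

end Strategy

/-- The reduced state of `A'ⱼ B`: the partial trace over all `A'ₖ` with `k ≠ j`. -/
def reduceTo {N d : ℕ} (j : Fin N)
    (τ : Matrix (Qudits N d × Fin d) (Qudits N d × Fin d) ℂ) :
    Matrix (Fin d × Fin d) (Fin d × Fin d) ℂ :=
  fun x y => ∑ f : Qudits N d,
    if f j = x.1 then τ (f, x.2) (Function.update f j y.1, y.2) else 0

namespace Strategy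

variable {N d : ℕ} (S : Strategy N d)

/-- The final state of `A'ⱼ B`, averaged over Alice's outcomes, when Bob's choice is `j`. -/
def finalState (j : Fin N) : Matrix (Fin d × Fin d) (Fin d × Fin d) ℂ :=
  ∑ i, reduceTo j (S.correctedState i j)

/-- The success probability `∑ⱼ pⱼ Fⱼ` of the strategy when the input to recover is drawn with
probabilities `p`; `Fⱼ` is the entanglement fidelity of the transmission of the `j`-th input. -/
def successProb (p : Fin N → ℝ) : ℝ :=
  ∑ j, p j * singletFraction (S.finalState j)

end Strategy

end CNSQRAC

end

/-!
Bob's attempt to recover the `j`-th input, given the outcome `i`, succeeds with the expectation of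
the projection `Pⱼ` onto the maximally entangled state of `A'ⱼ` and `B`, rotated by his unitary,
in the state `σᵢ` of `A' B` that Alice's outcome leaves behind. The `σᵢ` are positive semidefinite
and their traces add up to `1` (`Strategy.postState_posSemidef`, `Strategy.sum_trace_postState`);
nothing else about the shared state and the measurement matters. It therefore suffices that
`‖∑ⱼ Pⱼ‖ ≤ 1 + (N - 1) / d` for arbitrary unitaries, since the success probability is at most
`1 / N` times this norm.

The norm bound expresses the monogamy of entanglement. Since `B` cannot be maximally entangled with
two references at once, `‖Pⱼ Pₖ‖ ≤ 1 / d` for `j ≠ k`, and hence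
`2 Re ⟨Pⱼ v, Pₖ v⟩ ≤ (‖Pⱼ v‖² + ‖Pₖ v‖²) / d` (`two_mul_re_sum_cross_le`). With
`c = 1 + (N - 1) / d` this gives `‖∑ⱼ Pⱼ v‖² ≤ c ∑ⱼ ‖Pⱼ v‖²`, and expanding
`0 ≤ ‖c v - ∑ⱼ Pⱼ v‖²` yields `∑ⱼ ⟨v, Pⱼ v⟩ ≤ c ‖v‖²`
(`sum_norm_sq_le_of_almost_orthogonal`). The passage from vectors to the operators `σᵢ` writes
`σᵢ = Lᴴ L` and sums over the conjugated rows of `L`.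
-/

noncomputable section

namespace CNSQRAC

/-! ### Almost orthogonal projections -/

/-- If `x j = P j v` for orthogonal projections `P j` whose pairwise overlaps are at most `ε`, the
sum of the `‖x j‖²` is at most `1 + (n - 1) ε` times `‖v‖²`. Only the two consequences of this
situation that the argument needs are assumed; the overlap is in the form it takes after the
inequality of arithmetic and geometric means. -/
theorem sum_norm_sq_le_of_almost_orthogonal {E ι : Type*} [NormedAddCommGroup E]
    [InnerProductSpace ℂ E] [Fintype ι] [Nonempty ι] {ε : ℝ} (hε : 0 ≤ ε) (v : E) (x : ι → E)
    (hproj : ∀ j, (inner ℂ v (x j)).re = ‖x j‖ ^ 2)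
    (hoff : ∀ j k, j ≠ k → 2 * (inner ℂ (x j) (x k)).re ≤ ε * (‖x j‖ ^ 2 + ‖x k‖ ^ 2)) :
    ∑ j, ‖x j‖ ^ 2 ≤ (1 + (Fintype.card ι - 1) * ε) * ‖v‖ ^ 2 := by
  classical
  set c : ℝ := 1 + (Fintype.card ι - 1) * ε with hc_def
  set s : ℝ := ∑ j, ‖x j‖ ^ 2 with hs_def
  have hcard : (1 : ℝ) ≤ Fintype.card ι := by
    exact_mod_cast Fintype.card_pos (α := ι)
  have hc : 0 < c := by
    have := mul_nonneg (sub_nonneg.mpr hcard) hε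
    linarith
  have hgram : ‖∑ j, x j‖ ^ 2 ≤ c * s := by
    have hpair : ∀ j k, (inner ℂ (x j) (x k)).re ≤
        ε / 2 * (‖x j‖ ^ 2 + ‖x k‖ ^ 2) + if j = k then (1 - ε) * ‖x j‖ ^ 2 else 0 := by
      intro j k
      split_ifs with h
      · subst h
        have : (inner ℂ (x j) (x j)).re = ‖x j‖ ^ 2 := inner_self_eq_norm_sq (𝕜 := ℂ) (x j)
        linarith
      · have := hoff j k h
        linarith
    calc ‖∑ j, x j‖ ^ 2 = (inner ℂ (∑ j, x j) (∑ j, x j)).re :=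
          (inner_self_eq_norm_sq (𝕜 := ℂ) _).symm
      _ = ∑ j, ∑ k, (inner ℂ (x j) (x k)).re := by
          simp only [sum_inner, inner_sum, Complex.re_sum]
          exact Finset.sum_comm
      _ ≤ ∑ j, ∑ k, (ε / 2 * (‖x j‖ ^ 2 + ‖x k‖ ^ 2)
            + if j = k then (1 - ε) * ‖x j‖ ^ 2 else 0) :=
          Finset.sum_le_sum fun j _ => Finset.sum_le_sum fun k _ => hpair j k
      _ = c * s := by
          simp only [Finset.sum_add_distrib, ← Finset.mul_sum, Finset.sum_const, Finset.card_univ,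
            nsmul_eq_mul, Finset.sum_ite_eq, Finset.mem_univ, if_true, ← hs_def, hc_def]
          ring
  have hcross : (inner ℂ ((c : ℂ) • v) (∑ j, x j)).re = c * s := by
    simp only [inner_smul_left, inner_sum, Complex.conj_ofReal, Complex.re_ofReal_mul,
      Complex.re_sum, hproj, hs_def, Finset.mul_sum]
  -- Expand `0 ≤ ‖c v - ∑ j, x j‖²` at the value of `c` that the Gram bound calls for.
  have hexp := norm_sub_sq (𝕜 := ℂ) ((c : ℂ) • v) (∑ j, x j)
  have hnn := sq_nonneg ‖(c : ℂ) • v - ∑ j, x j‖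
  have hnorm : ‖(c : ℂ) • v‖ ^ 2 = c ^ 2 * ‖v‖ ^ 2 := by
    rw [norm_smul, mul_pow, Complex.norm_real, Real.norm_eq_abs, sq_abs]
  have hcross' : RCLike.re (inner ℂ ((c : ℂ) • v) (∑ j, x j)) = c * s := hcross
  rw [hexp, hnorm, hcross'] at hnn
  have : 0 ≤ c * (c * ‖v‖ ^ 2 - s) := by nlinarith
  linarith [nonneg_of_mul_nonneg_right this hc]

/-! ### Sums over basis vectors -/

variable {N d : ℕ}

/-- Resetting the `k`-th letter in all possible ways visits every word `d` times. -/
theorem sum_sum_update {β : Type*} [AddCommMonoid β] (k : Fin N) (h : Qudits N d → β) :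
    ∑ f, ∑ b, h (Function.update f k b) = d • ∑ f, h f := by
  have e : ∑ p : Qudits N d × Fin d, h (Function.update p.1 k p.2) =
      ∑ p : Qudits N d × Fin d, h p.1 := by
    -- Exchanging the `k`-th letter of the word with the free letter is an involution.
    let σ : Qudits N d × Fin d → Qudits N d × Fin d :=
      fun p => (Function.update p.1 k p.2, p.1 k)
    have hσ : Function.Involutive σ := fun p => by simp [σ]
    exact Equiv.sum_comp hσ.toPerm (fun p : Qudits N d × Fin d => h p.1)
  rw [Fintype.sum_prod_type, Fintype.sum_prod_type] at e
  rw [e]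
  simp [Finset.smul_sum]

/-- The entrywise conjugate of a unitary matrix preserves the norm. -/
theorem sum_normSq_star_mul {G : Matrix (Fin d) (Fin d) ℂ} (hG : G * Gᴴ = 1)
    (p : Fin d → ℂ) :
    ∑ a, Complex.normSq (∑ b, star (G a b) * p b) = ∑ b, Complex.normSq (p b) := by
  have hG' : Gᴴ * G = 1 := mul_eq_one_comm.mp hG
  have key : star ((G.map star) *ᵥ p) ⬝ᵥ ((G.map star) *ᵥ p) = star p ⬝ᵥ p := by
    rw [Matrix.star_mulVec, ← Matrix.dotProduct_mulVec, Matrix.mulVec_mulVec]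
    have : (G.map star)ᴴ * G.map star = 1 := by
      have := congrArg Matrix.transpose hG'
      rw [Matrix.transpose_mul, Matrix.transpose_one] at this
      rw [← this]
      ext i j
      simp [Matrix.mul_apply]
    rw [this, Matrix.one_mulVec]
  simp only [dotProduct, Pi.star_apply, Complex.star_def, ← Complex.normSq_eq_conj_mul_self,
    ← Complex.ofReal_sum] at key
  exact Complex.ofReal_injective key

/-- The overlap estimate for two different inputs. For fixed letters off `j` and `k`, the summand
pairs the vector `s`, which depends only on the letter at `k`, with the vector `t`, which depends
only on the letter at `j`, through the unitary `G`. This pairing is at most the product of the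
norms; the factor `d` arises because `∑ f` counts each of the two vectors `d` times. -/
theorem two_mul_re_sum_cross_le {j k : Fin N} (hjk : j ≠ k) {G : Matrix (Fin d) (Fin d) ℂ}
    (hG : G * Gᴴ = 1) {s t : Qudits N d → ℂ}
    (hs : ∀ f a, s (Function.update f j a) = s f) (ht : ∀ f a, t (Function.update f k a) = t f) :
    2 * (d * (∑ f, G (f j) (f k) * (star (s f) * t f)).re) ≤
      ∑ f, Complex.normSq (s f) + ∑ f, Complex.normSq (t f) := by
  rcases Nat.eq_zero_or_pos d with rfl | hd
  · simpa using add_nonneg (Finset.sum_nonneg fun f _ => Complex.normSq_nonneg (s f))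
      (Finset.sum_nonneg fun f _ => Complex.normSq_nonneg (t f))
  have hd' : (d : ℝ) ≠ 0 := by positivity
  -- `r` is `s` transported by the adjoint of the unitary to a function of the letter at `j`, so
  -- that the claim becomes `2 Re ⟨r, t⟩ ≤ ‖r‖² + ‖t‖²`.
  set r : Qudits N d → ℂ := fun f => ∑ b, star (G (f j) b) * s (Function.update f k b) with hr
  have hrsq : ∑ f, Complex.normSq (r f) = ∑ f, Complex.normSq (s f) := by
    have h1 : ∀ f, ∑ a, Complex.normSq (r (Function.update f j a)) =
        ∑ b, Complex.normSq (s (Function.update f k b)) := by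
      intro f
      rw [← sum_normSq_star_mul hG fun b => s (Function.update f k b)]
      refine Finset.sum_congr rfl fun a _ => ?_
      simp only [hr, Function.update_self]
      congr 1
      refine Finset.sum_congr rfl fun b _ => ?_
      rw [Function.update_comm hjk, hs]
    have h2 : d • ∑ f, Complex.normSq (r f) = d • ∑ f, Complex.normSq (s f) := by
      rw [← sum_sum_update j, ← sum_sum_update k]
      exact Finset.sum_congr rfl fun f _ => h1 f
    simpa [hd'] using h2
  have hcross : ∑ f, star (r f) * t f = d * ∑ f, G (f j) (f k) * (star (s f) * t f) := by
    rw [← nsmul_eq_mul, ← sum_sum_update k]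
    refine Finset.sum_congr rfl fun f _ => ?_
    simp only [hr, star_sum, star_mul', star_star, Finset.sum_mul, ht, Function.update_self,
      Function.update_of_ne hjk, mul_assoc]
  have hre : (d * (∑ f, G (f j) (f k) * (star (s f) * t f)).re) = ∑ f, (star (r f) * t f).re := by
    rw [← Complex.re_sum, hcross, ← Complex.ofReal_natCast, Complex.re_ofReal_mul]
  rw [hre, ← hrsq, Finset.mul_sum, ← Finset.sum_add_distrib]
  refine Finset.sum_le_sum fun f _ => ?_
  simp only [Complex.star_def, Complex.mul_re, Complex.conj_re, Complex.conj_im,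
    Complex.normSq_apply]
  nlinarith [sq_nonneg ((r f).re - (t f).re), sq_nonneg ((r f).im - (t f).im)]

/-! ### The projections onto the maximally entangled states -/

/-- The vector `(1 ⊗ V) v`, where `V` acts on Bob's system. -/
def rotate (V : Matrix (Fin d) (Fin d) ℂ) (v : Qudits N d × Fin d → ℂ) :
    Qudits N d × Fin d → ℂ :=
  fun x => ∑ b, V x.2 b * v (x.1, b)

/-- The contraction `√d ⟨ψ⁺| w` of the systems `A'ⱼ` and `B`. Its value is kept as a function of a
word on all the references; this function does not depend on the letter at `j`. -/
def contract (j : Fin N) (w : Qudits N d × Fin d → ℂ) : Qudits N d → ℂ :=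
  fun f => ∑ a, w (Function.update f j a, a)

theorem contract_update (j : Fin N) (w : Qudits N d × Fin d → ℂ) (f : Qudits N d) (a : Fin d) :
    contract j w (Function.update f j a) = contract j w f := by
  simp [contract]

theorem sum_mul_star_contract (j : Fin N) (w : Qudits N d × Fin d → ℂ) :
    d * ∑ f, w (f, f j) * star (contract j w f) =
      ((∑ f, Complex.normSq (contract j w f) : ℝ) : ℂ) := by
  rw [← nsmul_eq_mul, ← sum_sum_update j, Complex.ofReal_sum]
  refine Finset.sum_congr rfl fun f _ => ?_
  simp only [contract_update, Function.update_self, ← Finset.sum_mul]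
  exact Complex.mul_conj _

theorem inner_toLp {ι : Type*} [Fintype ι] (x y : ι → ℂ) :
    inner ℂ (WithLp.toLp 2 x : EuclideanSpace ℂ ι) (WithLp.toLp 2 y) = ∑ i, star (x i) * y i := by
  simp [PiLp.inner_apply, mul_comm]

/-- The image of `v` under the orthogonal projection `(1 ⊗ V)ᴴ (ψ⁺_{A'ⱼB} ⊗ 1) (1 ⊗ V)`, for a
unitary `V` on Bob's system. -/
def entProj (j : Fin N) (V : Matrix (Fin d) (Fin d) ℂ) (v : Qudits N d × Fin d → ℂ) :
    Qudits N d × Fin d → ℂ :=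
  fun x => (d : ℂ)⁻¹ * (star (V (x.1 j) x.2) * contract j (rotate V v) x.1)

/-- The expectation of the projection; for a unitary `V` it agrees with the squared norm of the
image, `sum_star_entProj_mul_self`. -/
theorem inner_entProj (j : Fin N) (V : Matrix (Fin d) (Fin d) ℂ) (v : Qudits N d × Fin d → ℂ) :
    ∑ x, star (v x) * entProj j V v x =
      (((d : ℝ)⁻¹ ^ 2 * ∑ f, Complex.normSq (contract j (rotate V v) f) : ℝ) : ℂ) := by
  rcases Nat.eq_zero_or_pos d with rfl | hd
  · simp
  have hd' : (d : ℂ) ≠ 0 := by exact_mod_cast hd.ne'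
  have h1 : ∑ x, star (v x) * entProj j V v x =
      (d : ℂ)⁻¹ * star (∑ f, rotate V v (f, f j) * star (contract j (rotate V v) f)) := by
    rw [Fintype.sum_prod_type, star_sum, Finset.mul_sum]
    refine Finset.sum_congr rfl fun f _ => ?_
    simp only [star_mul', star_star]
    simp only [entProj, rotate, star_sum, star_mul', Finset.sum_mul, Finset.mul_sum]
    refine Finset.sum_congr rfl fun b _ => ?_
    ring
  have h2 := congrArg (fun z => (d : ℂ)⁻¹ * star z) (sum_mul_star_contract j (rotate V v))
  simp only [star_mul', star_natCast, Complex.star_def, Complex.conj_ofReal] at h2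
  rw [inv_mul_cancel_left₀ hd'] at h2
  rw [h1, Complex.star_def, h2]
  push_cast
  ring

theorem sum_star_entProj_mul (j k : Fin N) (V W : Matrix (Fin d) (Fin d) ℂ)
    (v : Qudits N d × Fin d → ℂ) :
    ∑ x, star (entProj j V v x) * entProj k W v x =
      (((d : ℝ)⁻¹ ^ 2 : ℝ) : ℂ) * ∑ f, (V * Wᴴ) (f j) (f k) *
        (star (contract j (rotate V v) f) * contract k (rotate W v) f) := by
  rw [Fintype.sum_prod_type, Finset.mul_sum]
  refine Finset.sum_congr rfl fun f _ => ?_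
  simp only [entProj, Matrix.mul_apply, Matrix.conjTranspose_apply, Finset.sum_mul, Finset.mul_sum,
    star_mul', star_star, star_inv₀, star_natCast]
  refine Finset.sum_congr rfl fun b _ => ?_
  push_cast
  ring

theorem sum_star_entProj_mul_self (j : Fin N) {V : Matrix (Fin d) (Fin d) ℂ} (hV : V * Vᴴ = 1)
    (v : Qudits N d × Fin d → ℂ) :
    ∑ x, star (entProj j V v x) * entProj j V v x =
      (((d : ℝ)⁻¹ ^ 2 * ∑ f, Complex.normSq (contract j (rotate V v) f) : ℝ) : ℂ) := by
  rw [sum_star_entProj_mul, hV]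
  simp only [Matrix.one_apply_eq, one_mul, Complex.star_def, ← Complex.normSq_eq_conj_mul_self]
  push_cast
  rfl

/-- The operator norm bound `‖∑ j, P j‖ ≤ 1 + (N - 1) / d` for the rotated projections `P j` onto
the maximally entangled states of `A'ⱼ` and `B`, as a bound on the quadratic form. -/
theorem sum_contract_le (hN : 1 ≤ N) (V : Fin N → Matrix (Fin d) (Fin d) ℂ)
    (hV : ∀ j, V j * (V j)ᴴ = 1) (v : Qudits N d × Fin d → ℂ) :
    ∑ j, (d : ℝ)⁻¹ ^ 2 * ∑ f, Complex.normSq (contract j (rotate (V j) v) f) ≤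
      (1 + ((N : ℝ) - 1) * (d : ℝ)⁻¹) * ∑ x, Complex.normSq (v x) := by
  have : Nonempty (Fin N) := ⟨⟨0, hN⟩⟩
  let x : Fin N → EuclideanSpace ℂ (Qudits N d × Fin d) :=
    fun j => WithLp.toLp 2 (entProj j (V j) v)
  have hx : ∀ j, ‖x j‖ ^ 2 =
      (d : ℝ)⁻¹ ^ 2 * ∑ f, Complex.normSq (contract j (rotate (V j) v) f) := by
    intro j
    rw [← inner_self_eq_norm_sq (𝕜 := ℂ) (x j), inner_toLp, sum_star_entProj_mul_self j (hV j)]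
    exact Complex.ofReal_re _
  have hv : ‖(WithLp.toLp 2 v : EuclideanSpace ℂ (Qudits N d × Fin d))‖ ^ 2 =
      ∑ x, Complex.normSq (v x) := by
    simp [EuclideanSpace.norm_sq_eq, Complex.normSq_eq_norm_sq]
  have main := sum_norm_sq_le_of_almost_orthogonal (ε := (d : ℝ)⁻¹) (by positivity)
    (WithLp.toLp 2 v) x ?_ ?_
  · simpa only [hx, hv, Fintype.card_fin] using main
  · intro j
    rw [hx, inner_toLp, inner_entProj]
    exact Complex.ofReal_re _
  · intro j k hjk
    rw [hx, hx, inner_toLp, sum_star_entProj_mul, Complex.re_ofReal_mul]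
    rcases Nat.eq_zero_or_pos d with rfl | hd
    · simp
    have hd' : (d : ℝ) ≠ 0 := by positivity
    have hG : (V j * (V k)ᴴ) * (V j * (V k)ᴴ)ᴴ = 1 := by
      rw [Matrix.conjTranspose_mul, Matrix.conjTranspose_conjTranspose, Matrix.mul_assoc,
        ← Matrix.mul_assoc (V k)ᴴ, mul_eq_one_comm.mp (hV k), Matrix.one_mul, hV]
    have h := two_mul_re_sum_cross_le hjk hG (contract_update j (rotate (V j) v))
      (contract_update k (rotate (V k) v))
    have := mul_le_mul_of_nonneg_left h (by positivity : 0 ≤ (d : ℝ)⁻¹ ^ 3)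
    calc _ = (d : ℝ)⁻¹ ^ 3 * _ := ?_
      _ ≤ _ := this
      _ = _ := by ring
    field_simp

/-! ### From vectors to positive semidefinite operators -/

open scoped MatrixOrder in
theorem _root_.Matrix.PosSemidef.exists_eq_conjTranspose_mul_self {n : Type*} [Fintype n]
    {A : Matrix n n ℂ} (hA : A.PosSemidef) : ∃ B : Matrix n n ℂ, A = Bᴴ * B := by
  classical
  exact CStarAlgebra.nonneg_iff_eq_star_mul_self.mp hA.nonneg

theorem inv_sqrt_mul_self (d : ℕ) :
    (((Real.sqrt d)⁻¹ : ℝ) : ℂ) * (((Real.sqrt d)⁻¹ : ℝ) : ℂ) = (((d : ℝ)⁻¹ : ℝ) : ℂ) := by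
  rw [← Complex.ofReal_mul, ← mul_inv, Real.mul_self_sqrt (Nat.cast_nonneg d)]

theorem singletFraction_eq (τ : Matrix (Fin d × Fin d) (Fin d × Fin d) ℂ) :
    singletFraction τ = (d : ℝ)⁻¹ * (∑ a, ∑ b, τ (a, a) (b, b)).re := by
  have : (maxEnt d * τ).trace = (((d : ℝ)⁻¹ : ℝ) : ℂ) * ∑ a, ∑ b, τ (a, a) (b, b) := by
    rw [← inv_sqrt_mul_self, Finset.sum_comm]
    simp only [Matrix.trace, Matrix.diag, Matrix.mul_apply, maxEnt, Matrix.vecMulVec_apply,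
      maxEntVec, Pi.star_apply, Fintype.sum_prod_type, apply_ite star, star_zero, ite_mul, mul_ite,
      zero_mul, mul_zero, Finset.sum_ite_eq, Finset.mem_univ, if_true, Finset.mul_sum,
      Complex.star_def, Complex.conj_ofReal, Finset.sum_ite_irrel, Finset.sum_const_zero]
  rw [singletFraction, this, Complex.re_ofReal_mul]

theorem sum_reduceTo (j : Fin N) (τ : Matrix (Qudits N d × Fin d) (Qudits N d × Fin d) ℂ) :
    ∑ a, ∑ b, reduceTo j τ (a, a) (b, b) =
      ∑ f, ∑ b, τ (f, f j) (Function.update f j b, b) := by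
  simp only [reduceTo]
  calc _ = ∑ a, ∑ f : Qudits N d, ∑ b,
        (if f j = a then τ (f, a) (Function.update f j b, b) else 0) :=
        Finset.sum_congr rfl fun a _ => Finset.sum_comm
    _ = ∑ f : Qudits N d, ∑ a, ∑ b,
        (if f j = a then τ (f, a) (Function.update f j b, b) else 0) := Finset.sum_comm
    _ = _ := by simp [Finset.sum_ite_irrel]

theorem conj_kronecker_apply {κ : Type*} [Fintype κ] (V : Matrix (Fin d) (Fin d) ℂ)
    (B : Matrix κ (Qudits N d × Fin d) ℂ) (x y : Qudits N d × Fin d) :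
    (((1 : Matrix (Qudits N d) (Qudits N d) ℂ) ⊗ₖ V) * (Bᴴ * B) *
      ((1 : Matrix (Qudits N d) (Qudits N d) ℂ) ⊗ₖ V)ᴴ) x y =
      ∑ k, rotate V (star (B k)) x * star (rotate V (star (B k)) y) := by
  have h : ∀ z k, (((1 : Matrix (Qudits N d) (Qudits N d) ℂ) ⊗ₖ V) * Bᴴ) z k =
      rotate V (star (B k)) z := by
    intro z k
    simp [Matrix.mul_apply, Fintype.sum_prod_type, Matrix.one_apply, rotate,
      Finset.sum_ite_irrel]
  have h' : ((1 : Matrix (Qudits N d) (Qudits N d) ℂ) ⊗ₖ V) * (Bᴴ * B) *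
      ((1 : Matrix (Qudits N d) (Qudits N d) ℂ) ⊗ₖ V)ᴴ =
      (((1 : Matrix (Qudits N d) (Qudits N d) ℂ) ⊗ₖ V) * Bᴴ) *
      (((1 : Matrix (Qudits N d) (Qudits N d) ℂ) ⊗ₖ V) * Bᴴ)ᴴ := by
    rw [Matrix.conjTranspose_mul, Matrix.conjTranspose_conjTranspose]
    simp only [Matrix.mul_assoc]
  rw [h', Matrix.mul_apply]
  simp only [Matrix.conjTranspose_apply, h]

theorem singletFraction_reduceTo (j : Fin N) (V : Matrix (Fin d) (Fin d) ℂ) {κ : Type*} [Fintype κ]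
    (B : Matrix κ (Qudits N d × Fin d) ℂ) :
    singletFraction (reduceTo j (((1 : Matrix (Qudits N d) (Qudits N d) ℂ) ⊗ₖ V) * (Bᴴ * B) *
      ((1 : Matrix (Qudits N d) (Qudits N d) ℂ) ⊗ₖ V)ᴴ)) =
    ∑ k, (d : ℝ)⁻¹ ^ 2 * ∑ f, Complex.normSq (contract j (rotate V (star (B k))) f) := by
  rcases Nat.eq_zero_or_pos d with rfl | hd
  · simp [singletFraction_eq]
  have hd' : (d : ℝ) ≠ 0 := by positivity
  have h1 : ∑ f : Qudits N d, ∑ b, (((1 : Matrix (Qudits N d) (Qudits N d) ℂ) ⊗ₖ V) * (Bᴴ * B) *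
      ((1 : Matrix (Qudits N d) (Qudits N d) ℂ) ⊗ₖ V)ᴴ) (f, f j) (Function.update f j b, b) =
      ∑ k, ∑ f, rotate V (star (B k)) (f, f j) *
        star (contract j (rotate V (star (B k))) f) := by
    rw [Finset.sum_comm (s := Finset.univ (α := κ))]
    refine Finset.sum_congr rfl fun f _ => ?_
    simp only [conj_kronecker_apply, contract, star_sum, Finset.mul_sum]
    exact Finset.sum_comm
  rw [singletFraction_eq, sum_reduceTo, h1, Complex.re_sum, Finset.mul_sum]
  refine Finset.sum_congr rfl fun k _ => ?_
  have h2 := congrArg Complex.re (sum_mul_star_contract j (rotate V (star (B k))))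
  rw [← Complex.ofReal_natCast, Complex.re_ofReal_mul, Complex.ofReal_re] at h2
  rw [← h2]
  field_simp

/-- The operator norm bound, tested on an arbitrary unnormalised state of `A' B`. -/
theorem sum_singletFraction_le (hN : 1 ≤ N) (V : Fin N → Matrix (Fin d) (Fin d) ℂ)
    (hV : ∀ j, V j * (V j)ᴴ = 1) {σ : Matrix (Qudits N d × Fin d) (Qudits N d × Fin d) ℂ}
    (hσ : σ.PosSemidef) :
    ∑ j, singletFraction (reduceTo j (((1 : Matrix (Qudits N d) (Qudits N d) ℂ) ⊗ₖ V j) * σ *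
      ((1 : Matrix (Qudits N d) (Qudits N d) ℂ) ⊗ₖ V j)ᴴ)) ≤
      (1 + ((N : ℝ) - 1) * (d : ℝ)⁻¹) * σ.trace.re := by
  obtain ⟨B, rfl⟩ := hσ.exists_eq_conjTranspose_mul_self
  have htr : (Bᴴ * B).trace.re = ∑ k, ∑ x, Complex.normSq ((star (B k)) x) := by
    rw [Finset.sum_comm]
    simp [Matrix.trace, Matrix.mul_apply, Complex.normSq_apply]
  simp only [singletFraction_reduceTo]
  rw [Finset.sum_comm, htr, Finset.mul_sum]
  exact Finset.sum_le_sum fun k _ => sum_contract_le hN V hV _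

/-! ### The states after Alice's measurement -/

/-- Although `(M ⊗ 1) τ` need not be Hermitian, its partial trace over the first system is positive
semidefinite: with `M = Cᴴ C`, it is the partial trace of `(C ⊗ 1) τ (C ⊗ 1)ᴴ`. -/
theorem partialTrace_mul_posSemidef {α β : Type*} [Fintype α] [Fintype β] [DecidableEq β]
    {M : Matrix α α ℂ} {τ : Matrix (α × β) (α × β) ℂ} (hM : M.PosSemidef) (hτ : τ.PosSemidef) :
    (Matrix.of fun x y => ∑ z, ((M ⊗ₖ (1 : Matrix β β ℂ)) * τ) (z, x) (z, y)).PosSemidef := by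
  obtain ⟨C, rfl⟩ := hM.exists_eq_conjTranspose_mul_self
  obtain ⟨R, rfl⟩ := hτ.exists_eq_conjTranspose_mul_self
  let L : Matrix (α × α × β) β ℂ :=
    Matrix.of fun p y => ∑ z, star (C p.1 z) * R p.2 (z, y)
  convert Matrix.posSemidef_conjTranspose_mul_self L using 1
  ext x y
  calc _ = ∑ z, ∑ z', ∑ c, ∑ r,
        star (C c z) * C c z' * (star (R r (z', x)) * R r (z, y)) := by
        simp only [Matrix.of_apply]
        refine Finset.sum_congr rfl fun z _ => ?_
        rw [Matrix.mul_apply, Fintype.sum_prod_type]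
        refine Finset.sum_congr rfl fun z' _ => ?_
        simp [Matrix.one_apply, Matrix.mul_apply (M := Cᴴ), Matrix.mul_apply (M := Rᴴ),
          Finset.sum_mul_sum]
    _ = ∑ c, ∑ r, ∑ z, ∑ z', star (C c z) * C c z' * (star (R r (z', x)) * R r (z, y)) := by
        have hswap : ∀ g : α → α → α → α × β → ℂ,
            ∑ z, ∑ z', ∑ c, ∑ r, g z z' c r = ∑ c, ∑ r, ∑ z, ∑ z', g z z' c r := by
          intro g
          simp only [← Fintype.sum_prod_type']
          let e : (α × α × α × α × β) ≃ (α × (α × β) × α × α) :=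
            { toFun := fun p => (p.2.2.1, p.2.2.2, p.1, p.2.1)
              invFun := fun p => (p.2.2.1, p.2.2.2, p.1, p.2.1)
              left_inv := fun _ => rfl
              right_inv := fun _ => rfl }
          exact Fintype.sum_equiv e _ _ fun _ => rfl
        exact hswap _
    _ = _ := by
        simp only [L, Matrix.mul_apply, Matrix.conjTranspose_apply, Matrix.of_apply, star_sum,
          star_mul', star_star, Fintype.sum_prod_type (α₁ := α) (α₂ := α × β), Finset.sum_mul_sum]
        refine Finset.sum_congr rfl fun c _ => Finset.sum_congr rfl fun r _ => ?_
        rw [Finset.sum_comm]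
        refine Finset.sum_congr rfl fun z _ => Finset.sum_congr rfl fun z' _ => ?_
        ring

theorem inputState_posSemidef (N d : ℕ) : (inputState N d).PosSemidef := by
  have : inputState N d =
      Matrix.vecMulVec (fun x : Qudits N d × Qudits N d => ∏ j, maxEntVec d (x.1 j, x.2 j))
        (star fun x : Qudits N d × Qudits N d => ∏ j, maxEntVec d (x.1 j, x.2 j)) := by
    ext x y
    simp [inputState, maxEnt, Matrix.vecMulVec_apply, Finset.prod_mul_distrib]
  rw [this]
  exact Matrix.posSemidef_vecMulVec_self_star _

theorem trace_maxEnt (hd : 1 ≤ d) : (maxEnt d).trace = 1 := by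
  have hd' : (d : ℂ) ≠ 0 := by exact_mod_cast (by omega : d ≠ 0)
  simp only [Matrix.trace, Matrix.diag, maxEnt, Matrix.vecMulVec_apply, maxEntVec, Pi.star_apply,
    Fintype.sum_prod_type, apply_ite star, star_zero, ite_mul, mul_ite, zero_mul, mul_zero,
    Finset.sum_ite_eq, Finset.mem_univ, if_true, Complex.star_def, Complex.conj_ofReal,
    inv_sqrt_mul_self]
  simp [hd']

theorem trace_inputState (N : ℕ) (hd : 1 ≤ d) : (inputState N d).trace = 1 := by
  have h := trace_maxEnt hd
  simp only [Matrix.trace, Matrix.diag, Fintype.sum_prod_type] at h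
  simp only [Matrix.trace, Matrix.diag, Fintype.sum_prod_type, inputState]
  calc _ = ∑ f : Qudits N d, ∏ j, ∑ b, maxEnt d (f j, b) (f j, b) :=
        Finset.sum_congr rfl fun f _ =>
          (Fintype.prod_sum fun j b => maxEnt d (f j, b) (f j, b)).symm
    _ = ∏ _j : Fin N, ∑ a, ∑ b, maxEnt d (a, b) (a, b) :=
        (Fintype.prod_sum fun _ a => ∑ b, maxEnt d (a, b) (a, b)).symm
    _ = 1 := by simp [h]

namespace Strategy

variable (S : Strategy N d)

theorem initialState_posSemidef : S.initialState.PosSemidef :=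
  ((inputState_posSemidef N d).kronecker S.ρ_posSemidef).submatrix
    fun x : (Qudits N d × Fin S.m) × (Qudits N d × Fin d) => ((x.2.1, x.1.1), (x.1.2, x.2.2))

theorem trace_initialState (hd : 1 ≤ d) : S.initialState.trace = 1 := by
  have h : S.initialState.trace = (inputState N d).trace * S.ρ.trace := by
    rw [← Matrix.trace_kronecker]
    let e : (Qudits N d × Fin S.m) × (Qudits N d × Fin d) ≃
        (Qudits N d × Qudits N d) × (Fin S.m × Fin d) :=
      { toFun := fun x => ((x.2.1, x.1.1), (x.1.2, x.2.2))
        invFun := fun x => ((x.1.2, x.2.1), (x.1.1, x.2.2))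
        left_inv := fun _ => rfl
        right_inv := fun _ => rfl }
    exact Equiv.sum_comp e fun x => (inputState N d ⊗ₖ S.ρ) x x
  rw [h, trace_inputState N hd, S.ρ_trace, one_mul]

theorem postState_posSemidef (i : Fin S.K) : (S.postState i).PosSemidef :=
  partialTrace_mul_posSemidef (S.M_posSemidef i) S.initialState_posSemidef

theorem sum_trace_postState (hd : 1 ≤ d) : ∑ i, (S.postState i).trace = 1 := by
  have h : ∀ i, (S.postState i).trace = (((S.M i) ⊗ₖ
      (1 : Matrix (Qudits N d × Fin d) (Qudits N d × Fin d) ℂ)) * S.initialState).trace := by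
    intro i
    simp only [Matrix.trace, Matrix.diag, postState]
    rw [Fintype.sum_prod_type (α₁ := Qudits N d × Fin S.m), Finset.sum_comm]
  have hsum : ∑ i, (S.M i) ⊗ₖ (1 : Matrix (Qudits N d × Fin d) (Qudits N d × Fin d) ℂ) = 1 := by
    rw [← Matrix.one_kronecker_one (m := Qudits N d × Fin S.m), ← S.M_sum]
    ext x y
    simp [Matrix.sum_apply, Finset.sum_mul]
  simp only [h]
  rw [← Matrix.trace_sum, ← Finset.sum_mul, hsum, one_mul, S.trace_initialState hd]

theorem singletFraction_finalState (j : Fin N) :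
    singletFraction (S.finalState j) = ∑ i, singletFraction (reduceTo j (S.correctedState i j)) := by
  simp only [singletFraction, finalState, Finset.mul_sum, Matrix.trace_sum, Complex.re_sum]

theorem sum_singletFraction_finalState_le (hN : 1 ≤ N) (hd : 1 ≤ d) :
    ∑ j, singletFraction (S.finalState j) ≤ 1 + ((N : ℝ) - 1) * (d : ℝ)⁻¹ := by
  simp only [singletFraction_finalState]
  rw [Finset.sum_comm]
  calc _ ≤ ∑ i, (1 + ((N : ℝ) - 1) * (d : ℝ)⁻¹) * (S.postState i).trace.re :=
        Finset.sum_le_sum fun i _ => sum_singletFraction_le hN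
          (fun j => (S.U i j : Matrix (Fin d) (Fin d) ℂ))
          (fun j => Matrix.mem_unitaryGroup_iff.mp (S.U i j).2) (S.postState_posSemidef i)
    _ = _ := by
        rw [← Finset.mul_sum, ← Complex.re_sum, S.sum_trace_postState hd, Complex.one_re, mul_one]

end Strategy

end CNSQRAC

end

theorem proposition3 (N d : ℕ) (hN : 1 ≤ N) (hd : 1 ≤ d) (S : CNSQRAC.Strategy N d) :
    S.successProb (fun _ => 1 / (N : ℝ)) ≤ ((N : ℝ) + (d : ℝ) - 1) / ((d : ℝ) * (N : ℝ)) := by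
  have hN' : (0 : ℝ) < N := by exact_mod_cast hN
  have hd' : (0 : ℝ) < d := by exact_mod_cast hd
  rw [CNSQRAC.Strategy.successProb, ← Finset.mul_sum]
  calc _ ≤ 1 / (N : ℝ) * (1 + ((N : ℝ) - 1) * (d : ℝ)⁻¹) := by
        gcongr
        exact S.sum_singletFraction_finalState_le hN hd
    _ = _ := by
        field_simp
        ring
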